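/- Let $(Z_t)_{t\ge 0}$ be a time-homogeneous continuous-time Markov chain with state space $E\subseteq\mathbb N$ on a probability space $(\Omega,\mathbb P)$, with an arbitrary initial distribution and with right-continuous paths that have left limits in $E$ (discrete topology). Its transition function $p_t(n,n')$ has transition rates $Q_{n,n'}\ge 0$: one has $Q_{n,n}=0$, and as $h\downarrow 0$, $p_h(n,n')=Q_{n,n'}h+o(h)$ for $n'\ne n$ and $p_h(n,n)=1-d_nh+o(h)$, where $d_n=\sum_{n'\in E}Q_{n,n'}<\infty$ is the sum of all outgoing rates from $n$. Assume $d_n>0$ for all $n\in E$. Let $\mathcal F\subseteq E\times E$ be such that $Q_{n,n'}>0$ for all $(n,n')\in\mathcal F$. For $t\ge 0$ let $Y^k_t\in[0,\infty]$, $k\ge 1$, be the time that elapses from $t$ until the $k$-th jump of the chain in $\mathcal F$, that is $$Y^1_t=\inf\{s\ge 0:\ (Z_{(t+s)^-},Z_{(t+s)^+})\in\mathcal F\},\qquad Y^k_t=\inf\{s> Y^{k-1}_t:\ (Z_{(t+s)^-},Z_{(t+s)^+})\in\mathcal F\}\quad(k\ge 2),$$ with $Z_{0^-}=Z_0$ and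 $\inf\emptyset=\infty$. Then for every $k\ge 1$, every $\theta\in\mathbb C$ with $\operatorname{Re}\theta\ge 0$ and every $n\in E$ with $\mathbb P(Z_t=n)>0$ for some $t$, the conditional Laplace--Stieltjes transform $$f_{n,k}(\theta)=\mathbb E\big[e^{-\theta Y^k_t}\,\big|\,Z_t=n\big]\qquad(e^{-\theta\cdot\infty}=0)$$ exists and does not depend on the time $t$ with $\mathbb P(Z_t=n)>0$ at which it is taken, and, with the convention $f_{n,0}(\theta)=1$, $$f_{n,k}(\theta)=\frac{1}{d_n+\theta}\Bigg(\sum_{n':\,(n,n')\notin\mathcal F}f_{n',k}(\theta)\,Q_{n,n'}+\sum_{n':\,(n,n')\in\mathcal F}f_{n',k-1}(\theta)\,Q_{n,n'}\Bigg),$$ where both series converge absolutely. (If $\mathbb P(Z_t=n')=0$ for all $t$, then $Q_{n,n'}=0$ and the value given to $f_{n',k}(\theta)$ is immaterial.) -/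

import Mathlib

open MeasureTheory ProbabilityTheory Filter Topology
open scoped NNReal ENNReal

/-- Transition functions `p t i j` of time-homogeneous Markov chains on a countable state
space `S`: stochastic matrices indexed by time, with `p 0 = 1` and the Chapman–Kolmogorov
equations. -/
structure IsTransitionFunction {S : Type*} (p : ℝ≥0 → S → S → ℝ) : Prop where
  nonneg : ∀ t i j, 0 ≤ p t i j
  hasSum_one : ∀ t i, HasSum (p t i) 1
  zero_self : ∀ i, p 0 i i = 1
  zero_of_ne : ∀ i j, i ≠ j → p 0 i j = 0
  hasSum_add : ∀ s t i j, HasSum (fun l => p s i l * p t l j) (p (s + t) i j)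

/-- `Q i j` is the rate of the transition from `i` to `j ≠ i` in the transition function `p`:
`p h i j = Q i j * h + o(h)` for `j ≠ i` and `1 - p h i i = d i * h + o(h)` as `h → 0+`, where
`d i = ∑ j, Q i j < ∞`. There are no transitions from a state to itself, so `Q i i = 0`. -/
structure HasTransitionRates {S : Type*} (p : ℝ≥0 → S → S → ℝ) (Q : S → S → ℝ) : Prop where
  rate_self : ∀ i, Q i i = 0
  summable_rate : ∀ i, Summable (Q i)
  tendsto_rate : ∀ i j, i ≠ j →
    Tendsto (fun h : ℝ≥0 => p h i j / (h : ℝ)) (𝓝[>] 0) (𝓝 (Q i j))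
  tendsto_total_rate : ∀ i,
    Tendsto (fun h : ℝ≥0 => (1 - p h i i) / (h : ℝ)) (𝓝[>] 0) (𝓝 (∑' j, Q i j))

/-- The process `Z` with values in the state space `E ⊆ ℕ` (with the discrete topology) is, under
the probability `P`, a continuous-time Markov chain with transition function `p` (and an arbitrary
initial distribution): its paths are right-continuous with left limits, and it has the Markov
property with respect to its own past `σ(Z u, u ≤ t)`. -/
structure IsMarkovChain {Ω : Type*} [MeasurableSpace Ω] (P : Measure Ω) {E : Set ℕ}
    (Z : ℝ≥0 → Ω → E) (p : ℝ≥0 → E → E → ℝ) : Prop where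
  measurable : ∀ t, Measurable (Z t)
  right_continuous : ∀ ω t, ContinuousWithinAt (fun u => Z u ω) (Set.Ioi t) t
  left_limits : ∀ ω t, ∃ l : E, Tendsto (fun u => Z u ω) (𝓝[<] t) (𝓝 l)
  markov : ∀ (t s : ℝ≥0) (i j : E) (A : Set Ω),
    MeasurableSet[⨆ u : Set.Iic t, MeasurableSpace.comap (Z u) inferInstance] A →
    P.real (A ∩ Z t ⁻¹' {i} ∩ Z (t + s) ⁻¹' {j}) = P.real (A ∩ Z t ⁻¹' {i}) * p s i j

/-- `jumpTime F z t k` is the time that elapses from `t` until the `k`-th jump in `F` of the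
path `z`; it is `∞` if there is no such jump. Here `Function.leftLim z 0 = z 0`, so that there is
no jump at time `0`. -/
noncomputable def jumpTime {E : Set ℕ} (F : Set (E × E)) (z : ℝ≥0 → E) (t : ℝ≥0) : ℕ → ℝ≥0∞
  | 0 => 0
  | 1 => ⨅ (s : ℝ≥0)
      (_ : (Function.leftLim z (t + s), Function.rightLim z (t + s)) ∈ F), (s : ℝ≥0∞)
  | k + 2 => ⨅ (s : ℝ≥0) (_ : jumpTime F z t (k + 1) < (s : ℝ≥0∞) ∧
      (Function.leftLim z (t + s), Function.rightLim z (t + s)) ∈ F), (s : ℝ≥0∞)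

/-- `e^{-θ y}` for `y ∈ [0, ∞]`, with `e^{-θ ∞} = 0`. -/
noncomputable def expNeg (θ : ℂ) (y : ℝ≥0∞) : ℂ :=
  if y = ∞ then 0 else Complex.exp (-θ * (y.toReal : ℂ))

/-- The conditional Laplace–Stieltjes transform at `θ` of the time from `t` until the `k`-th jump
in `F`, given the event `Z t = n` (meaningful if this event has positive probability). -/
noncomputable def condLST {Ω : Type*} [MeasurableSpace Ω] (P : Measure Ω) {E : Set ℕ}
    (Z : ℝ≥0 → Ω → E) (F : Set (E × E)) (t : ℝ≥0) (k : ℕ) (θ : ℂ) (n : E) : ℂ :=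
  ∫ ω, expNeg θ (jumpTime F (fun u => Z u ω) t k) ∂(P[|Z t ⁻¹' {n}])

/-! The recurrence is first-step analysis, carried out on the chain observed at the times `t + i h`
and passed to the limit `h → 0`; neither holding times nor the strong Markov property enter.

The skeleton is a discrete Markov sequence with matrix `p h`. With `r = e^{-θh}`, the mean `g_k(n)`
of `e^{-θY}` for its `k`-th transition in `F` satisfies `g_{k+1}(n) = r ∑ p_h(n,n') g_κ(n')`, where
`κ` is `k` or `k + 1` according to whether `(n,n') ∈ F` (`setIntegral_expNeg_grid`,
`gridMean_succ`). Moving the diagonal term to the left and dividing by `h` gives `(r (1 -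
p_h(n,n))/h + (1 - r)/h) g_{k+1}(n) = r ∑_{n' ≠ n} (p_h(n,n')/h) g_κ(n')`, whose formal limit is the
claim multiplied by `d_n + θ`.

Two limits need proof. Along a càdlàg path in a discrete space the grid jump times converge to the
true ones (`tendsto_orderedPoint_gridJumps`), so by dominated convergence `g_k(n)` tends to the
conditional transform (`tendsto_gridMean_condLST`). As `g_k(n)` does not involve `t`, neither does
the transform. The sum over `n'` converges because the off-diagonal rates converge in `ℓ¹`, by
Scheffé's argument (`tendsto_tsum_mul_of_tendsto_tsum`).

All this requires `Re θ > 0`, where `|r| < 1` and `e^{-θy}` is continuous at `y = ∞`. The boundary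
`Re θ = 0` follows by letting `θ + ε → θ`. -/

/-! ### Ordered points of a set of times, and their shift under one grid step. -/

/-- The `k`-th point (`k ≥ 1`) of a set of positive times, in increasing order. -/
noncomputable def orderedPoint (A : Set ℝ≥0) : ℕ → ℝ≥0∞
  | 0 => 0
  | k + 1 => ⨅ (s : ℝ≥0) (_ : s ∈ A ∧ orderedPoint A k < (s : ℝ≥0∞)), (s : ℝ≥0∞)

theorem orderedPoint_succ_le {A : Set ℝ≥0} {k : ℕ} {s : ℝ≥0} (hs : s ∈ A)
    (h : orderedPoint A k < s) : orderedPoint A (k + 1) ≤ s :=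
  iInf₂_le s ⟨hs, h⟩

theorem le_orderedPoint_succ {A : Set ℝ≥0} {k : ℕ} {b : ℝ≥0∞}
    (h : ∀ s ∈ A, orderedPoint A k < s → b ≤ s) : b ≤ orderedPoint A (k + 1) :=
  le_iInf₂ fun s hs => h s hs.1 hs.2

theorem orderedPoint_le_succ (A : Set ℝ≥0) (k : ℕ) :
    orderedPoint A k ≤ orderedPoint A (k + 1) :=
  le_orderedPoint_succ fun _ _ h => h.le

theorem orderedPoint_image_add {A : Set ℝ≥0} (hA : ∀ s ∈ A, 0 < s) (h : ℝ≥0) (k : ℕ) :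
    orderedPoint ((h + ·) '' A) (k + 1) = h + orderedPoint A (k + 1) := by
  induction k with
  | zero =>
    apply le_antisymm
    · rw [orderedPoint.eq_2 A, ENNReal.add_iInf]
      refine le_iInf fun s => ?_
      rw [ENNReal.add_iInf]
      refine le_iInf fun hs => ?_
      rw [← ENNReal.coe_add]
      refine orderedPoint_succ_le ⟨s, hs.1, rfl⟩ ?_
      have := hA s hs.1
      simp only [orderedPoint]
      exact_mod_cast this.trans_le le_add_self
    · refine le_orderedPoint_succ ?_
      rintro _ ⟨s, hs, rfl⟩ _
      rw [ENNReal.coe_add]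
      gcongr
      exact orderedPoint_succ_le hs (by simpa [orderedPoint] using hA s hs)
  | succ k ih =>
    apply le_antisymm
    · rw [orderedPoint.eq_2 A, ENNReal.add_iInf]
      refine le_iInf fun s => ?_
      rw [ENNReal.add_iInf]
      refine le_iInf fun hs => ?_
      rw [← ENNReal.coe_add]
      refine orderedPoint_succ_le ⟨s, hs.1, rfl⟩ ?_
      rw [ih, ENNReal.coe_add]
      exact (ENNReal.add_lt_add_iff_left ENNReal.coe_ne_top).2 hs.2
    · refine le_orderedPoint_succ ?_
      rintro _ ⟨s, hs, rfl⟩ h2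
      rw [ih, ENNReal.coe_add, ENNReal.add_lt_add_iff_left ENNReal.coe_ne_top] at h2
      rw [ENNReal.coe_add]
      gcongr
      exact orderedPoint_succ_le hs h2

/-- Here the inserted `h` is itself the first point, so the index on the right drops by one; this is
the case where the first grid step is a transition in `F`. -/
theorem orderedPoint_insert_image_add {A : Set ℝ≥0} {h : ℝ≥0}
    (hh : 0 < h) (k : ℕ) :
    orderedPoint (insert h ((h + ·) '' A)) (k + 1) = h + orderedPoint A k := by
  induction k with
  | zero =>
    apply le_antisymm
    · simpa [orderedPoint] using
        orderedPoint_succ_le (k := 0) (Set.mem_insert h ((h + ·) '' A)) (by simpa [orderedPoint])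
    · refine le_orderedPoint_succ ?_
      rintro s (rfl | ⟨s, hs, rfl⟩) _ <;> simp [orderedPoint]
  | succ k ih =>
    apply le_antisymm
    · rw [orderedPoint.eq_2 A, ENNReal.add_iInf]
      refine le_iInf fun s => ?_
      rw [ENNReal.add_iInf]
      refine le_iInf fun hs => ?_
      rw [← ENNReal.coe_add]
      refine orderedPoint_succ_le (Or.inr ⟨s, hs.1, rfl⟩) ?_
      rw [ih, ENNReal.coe_add]
      exact (ENNReal.add_lt_add_iff_left ENNReal.coe_ne_top).2 hs.2
    · refine le_orderedPoint_succ ?_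
      rintro _ (rfl | ⟨s, hs, rfl⟩) h2
      · rw [ih] at h2
        exact absurd h2 (not_lt.2 le_self_add)
      · rw [ih, ENNReal.coe_add, ENNReal.add_lt_add_iff_left ENNReal.coe_ne_top] at h2
        rw [ENNReal.coe_add]
        gcongr
        exact orderedPoint_succ_le hs h2

/-- The times `(i + 1) h` at which a sequence, read with step `h`, makes a transition in `F`. -/
def gridJumps {S : Type*} (F : Set (S × S)) (h : ℝ≥0) (x : ℕ → S) : Set ℝ≥0 :=
  {s | ∃ i : ℕ, (x i, x (i + 1)) ∈ F ∧ s = (i + 1) * h}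

theorem pos_of_mem_gridJumps {S : Type*} {F : Set (S × S)} {h : ℝ≥0} (hh : 0 < h) {x : ℕ → S}
    {s : ℝ≥0} (hs : s ∈ gridJumps F h x) : 0 < s := by
  obtain ⟨i, -, rfl⟩ := hs
  positivity

-- First-step decomposition of the waiting time, pathwise: one step costs `h`, and the count
-- decreases exactly when that step lies in `F`.
open Classical in
theorem orderedPoint_gridJumps_succ {S : Type*} (F : Set (S × S)) {h : ℝ≥0} (hh : 0 < h)
    (x : ℕ → S) (k : ℕ) :
    orderedPoint (gridJumps F h x) (k + 1) =
      h + orderedPoint (gridJumps F h fun i => x (i + 1)) (if (x 0, x 1) ∈ F then k else k + 1) := by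
  split_ifs with h0
  · rw [← orderedPoint_insert_image_add hh]
    congr 1
    ext s
    constructor
    · rintro ⟨i, hi, rfl⟩
      rcases i with _ | i
      · left; simp
      · right; exact ⟨_, ⟨i, hi, rfl⟩, by push_cast; ring⟩
    · rintro (rfl | ⟨_, ⟨i, hi, rfl⟩, rfl⟩)
      · exact ⟨0, h0, by simp⟩
      · exact ⟨i + 1, hi, by push_cast; ring⟩
  · rw [← orderedPoint_image_add (fun s => pos_of_mem_gridJumps hh)]
    congr 1
    ext s
    constructor
    · rintro ⟨i, hi, rfl⟩
      rcases i with _ | i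
      · exact absurd hi h0
      · exact ⟨_, ⟨i, hi, rfl⟩, by push_cast; ring⟩
    · rintro ⟨_, ⟨i, hi, rfl⟩, rfl⟩
      exact ⟨i + 1, hi, by push_cast; ring⟩

/-! ### Convergence of ordered points under rounding up to a grid. -/

section Discretization

/-- The least multiple of `h` that is not smaller than `a`. -/
noncomputable def ceilMul (h a : ℝ≥0) : ℝ≥0 := ⌈a / h⌉₊ * h

theorem le_ceilMul {h : ℝ≥0} (hh : 0 < h) (a : ℝ≥0) : a ≤ ceilMul h a := by
  rw [ceilMul, ← div_le_iff₀ hh]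
  exact Nat.le_ceil _

theorem ceilMul_lt_add {h : ℝ≥0} (hh : 0 < h) (a : ℝ≥0) : ceilMul h a < a + h := by
  have h1 : (⌈a / h⌉₊ : ℝ≥0) < a / h + 1 := Nat.ceil_lt_add_one (zero_le)
  calc ceilMul h a < (a / h + 1) * h := by
        unfold ceilMul; gcongr
    _ = a + h := by field_simp

theorem ceilMul_mono (h : ℝ≥0) : Monotone (ceilMul h) := by
  intro a b hab
  unfold ceilMul
  gcongr

theorem ceilMul_eq_of_mem {h : ℝ≥0} (hh : 0 < h) {i : ℕ} {c : ℝ≥0} (h1 : i * h < c)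
    (h2 : c ≤ (i + 1) * h) : ceilMul h c = (i + 1) * h := by
  have : ⌈c / h⌉₊ = i + 1 := by
    rw [Nat.ceil_eq_iff (by simp)]
    constructor
    · rw [lt_div_iff₀ hh]; simpa using h1
    · rw [div_le_iff₀ hh]; simpa using h2
  rw [ceilMul, this]; push_cast; rfl

theorem exists_ceilMul_eq {h : ℝ≥0} (hh : 0 < h) {c : ℝ≥0} (hc : 0 < c) :
    ∃ i : ℕ, ceilMul h c = (i + 1) * h ∧ i * h < c ∧ c ≤ (i + 1) * h := by
  have h0 : ⌈c / h⌉₊ ≠ 0 := by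
    simp only [ne_eq, Nat.ceil_eq_zero, not_le]; positivity
  obtain ⟨i, hi⟩ := Nat.exists_eq_succ_of_ne_zero h0
  have h3 := (Nat.ceil_eq_iff i.succ_ne_zero).1 hi
  refine ⟨i, ?_, ?_, ?_⟩
  · rw [ceilMul, hi]; push_cast; rfl
  · have := h3.1; rw [lt_div_iff₀ hh] at this; simpa using this
  · have := h3.2; rw [div_le_iff₀ hh] at this; simpa using this

variable {ι : Type*} {l : Filter ι} {η : ι → ℝ≥0} {A : Set ℝ≥0} {B : ι → Set ℝ≥0}

/-- Since points of `A` do not accumulate from the right, a finite infimum is attained. -/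
theorem orderedPoint_succ_mem (hA : ∀ b, ∀ᶠ s in 𝓝[>] b, s ∉ A) {k : ℕ} {b : ℝ≥0}
    (hb : orderedPoint A (k + 1) = b) : b ∈ A ∧ orderedPoint A k < b := by
  by_contra hcon
  obtain ⟨u, hu, hu'⟩ := (mem_nhdsGT_iff_exists_Ioo_subset).1 (hA b)
  have : (u : ℝ≥0∞) ≤ orderedPoint A (k + 1) := by
    refine le_orderedPoint_succ fun s hs hks => ?_
    by_contra hsu
    have hsu : s < u := by simpa using hsu
    have hbs : b ≤ s := by
      have := orderedPoint_succ_le hs hks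
      rw [hb] at this; exact_mod_cast this
    rcases hbs.eq_or_lt with rfl | hbs
    · exact hcon ⟨hs, hks⟩
    · exact hu' ⟨hbs, hsu⟩ hs
  rw [hb] at this
  exact absurd hu (not_lt.2 (by exact_mod_cast this))

/-- A grid time is marked exactly when its cell `(iη, (i+1)η]` meets `A`, so each point is seen at
its rounding up. Once the mesh is below the gap between consecutive points their roundings differ,
and no point is lost by merging. Exact equality, rather than mere convergence, is what lets the
induction on `k` compare strict inequalities. -/
theorem orderedPoint_grid_eventually (hη : Tendsto η l (𝓝[>] 0))
    (hA0 : ∀ s ∈ A, 0 < s) (hA : ∀ b, ∀ᶠ s in 𝓝[>] b, s ∉ A)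
    (hB : ∀ j, ∀ s ∈ B j, ∃ i : ℕ, s = (i + 1) * η j)
    (hAB : ∀ T : ℝ≥0, ∀ᶠ j in l, ∀ i : ℕ, (i + 1) * η j ≤ T →
      (((i : ℝ≥0) + 1) * η j ∈ B j ↔ ∃ c ∈ A, i * η j < c ∧ c ≤ (i + 1) * η j)) (k : ℕ) :
    (∀ a : ℝ≥0, orderedPoint A k = a →
      ∀ᶠ j in l, orderedPoint (B j) k = ceilMul (η j) a) ∧
    (orderedPoint A k = ∞ → ∀ T : ℝ≥0, ∀ᶠ j in l, (T : ℝ≥0∞) ≤ orderedPoint (B j) k) := by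
  have hpos : ∀ᶠ j in l, 0 < η j := hη.eventually self_mem_nhdsWithin
  have hsmall : ∀ ε : ℝ≥0, 0 < ε → ∀ᶠ j in l, η j < ε := fun ε hε =>
    (tendsto_nhds_of_tendsto_nhdsWithin hη).eventually (gt_mem_nhds hε)
  induction k with
  | zero =>
    refine ⟨fun a ha => ?_, fun h => ?_⟩
    · have : a = 0 := by simpa [orderedPoint] using ha.symm
      subst this
      exact Eventually.of_forall fun j => by simp [orderedPoint, ceilMul]
    · simp [orderedPoint] at h
  | succ k ih =>
    rcases eq_or_ne (orderedPoint A k) ∞ with hk | hk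
    · refine ⟨fun a ha => ?_, fun h T => ?_⟩
      · have := orderedPoint_le_succ A k
        rw [hk, ha] at this
        simp at this
      · filter_upwards [ih.2 hk T] with j hj
        exact hj.trans (orderedPoint_le_succ _ _)
    obtain ⟨a, ha⟩ : ∃ a : ℝ≥0, (a : ℝ≥0∞) = orderedPoint A k := ⟨_, ENNReal.coe_toNNReal hk⟩
    have ih1 := ih.1 a ha.symm
    refine ⟨fun b hb => ?_, fun h T => ?_⟩
    · obtain ⟨hbA, hab⟩ := orderedPoint_succ_mem hA hb
      rw [← ha] at hab
      have hab : a < b := by exact_mod_cast hab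
      -- The mesh is taken below `b - a`, so the rounding of `b` stays below the horizon `b + (b -
      -- a)`.
      filter_upwards [ih1, hpos, hsmall _ (tsub_pos_of_lt hab), hAB (b + (b - a))]
        with j hj hj0 hjs hjB
      have hlt : ceilMul (η j) a < ceilMul (η j) b := by
        refine (ceilMul_lt_add hj0 a).trans_le (le_trans ?_ (le_ceilMul hj0 b))
        rw [← add_tsub_cancel_of_le hab.le]
        gcongr
      apply le_antisymm
      · apply orderedPoint_succ_le
        · obtain ⟨i, hi, hi1, hi2⟩ := exists_ceilMul_eq hj0 (hA0 b hbA)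
          rw [hi]
          refine (hjB i ?_).2 ⟨b, hbA, hi1, hi2⟩
          rw [← hi]
          exact (ceilMul_lt_add hj0 b).le.trans (by gcongr)
        · rw [hj]; exact_mod_cast hlt
      · refine le_orderedPoint_succ fun s hs hks => ?_
        rw [hj] at hks
        have hks : ceilMul (η j) a < s := by exact_mod_cast hks
        by_contra hcon
        have hcon : s < ceilMul (η j) b := by simpa using hcon
        obtain ⟨i, rfl⟩ := hB j s hs
        obtain ⟨c, hcA, hc1, hc2⟩ := (hjB i (hcon.le.trans
          ((ceilMul_lt_add hj0 b).le.trans (by gcongr)))).1 hs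
        have hc := ceilMul_eq_of_mem hj0 hc1 hc2
        rw [← hc] at hks hcon
        have hac : a < c := (ceilMul_mono (η j)).reflect_lt hks
        have hcb : c < b := (ceilMul_mono (η j)).reflect_lt hcon
        have := orderedPoint_succ_le hcA (k := k) (by rw [← ha]; exact_mod_cast hac)
        rw [hb] at this
        exact absurd hcb (not_lt.2 (by exact_mod_cast this))
    · filter_upwards [ih1, hpos, hAB T] with j hj hj0 hjB
      refine le_orderedPoint_succ fun s hs hks => ?_
      rw [hj] at hks
      have hks : ceilMul (η j) a < s := by exact_mod_cast hks
      by_contra hcon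
      have hcon : s < T := by simpa using hcon
      obtain ⟨i, rfl⟩ := hB j s hs
      obtain ⟨c, hcA, hc1, hc2⟩ := (hjB i hcon.le).1 hs
      rw [← ceilMul_eq_of_mem hj0 hc1 hc2] at hks
      have hac : a < c := (ceilMul_mono (η j)).reflect_lt hks
      have := orderedPoint_succ_le hcA (k := k) (by rw [← ha]; exact_mod_cast hac)
      rw [h] at this
      simp at this

theorem tendsto_orderedPoint_grid (hη : Tendsto η l (𝓝[>] 0))
    (hA0 : ∀ s ∈ A, 0 < s) (hA : ∀ b, ∀ᶠ s in 𝓝[>] b, s ∉ A)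
    (hB : ∀ j, ∀ s ∈ B j, ∃ i : ℕ, s = (i + 1) * η j)
    (hAB : ∀ T : ℝ≥0, ∀ᶠ j in l, ∀ i : ℕ, (i + 1) * η j ≤ T →
      (((i : ℝ≥0) + 1) * η j ∈ B j ↔ ∃ c ∈ A, i * η j < c ∧ c ≤ (i + 1) * η j)) (k : ℕ) :
    Tendsto (fun j => orderedPoint (B j) k) l (𝓝 (orderedPoint A k)) := by
  have key := orderedPoint_grid_eventually hη hA0 hA hB hAB k
  have hpos : ∀ᶠ j in l, 0 < η j := hη.eventually self_mem_nhdsWithin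
  rcases eq_or_ne (orderedPoint A k) ∞ with hk | hk
  · rw [hk, ENNReal.tendsto_nhds_top_iff_nnreal]
    intro T
    filter_upwards [key.2 hk (T + 1)] with j hj
    refine lt_of_lt_of_le ?_ hj
    exact_mod_cast lt_add_one T
  · obtain ⟨a, ha⟩ : ∃ a : ℝ≥0, (a : ℝ≥0∞) = orderedPoint A k := ⟨_, ENNReal.coe_toNNReal hk⟩
    rw [← ha]
    have h1 : Tendsto (fun j => ceilMul (η j) a) l (𝓝 a) := by
      have h2 : Tendsto (fun j => a + η j) l (𝓝 a) := by
        simpa using (tendsto_nhds_of_tendsto_nhdsWithin hη).const_add a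
      refine tendsto_of_tendsto_of_tendsto_of_le_of_le' tendsto_const_nhds h2 ?_ ?_
      · filter_upwards [hpos] with j hj using le_ceilMul hj a
      · filter_upwards [hpos] with j hj using (ceilMul_lt_add hj a).le
    refine (ENNReal.tendsto_coe.2 h1).congr' ?_
    filter_upwards [key.1 a ha.symm] with j hj using hj.symm

end Discretization

/-! ### Càdlàg paths in a discrete space. -/

section Paths

variable {E : Set ℕ} {z : ℝ≥0 → E}

/-- The times `s > 0` at which the path makes a transition in `F` at `t + s`. -/
def jumpSet (F : Set (E × E)) (z : ℝ≥0 → E) (t : ℝ≥0) : Set ℝ≥0 :=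
  {s | 0 < s ∧ (Function.leftLim z (t + s), Function.rightLim z (t + s)) ∈ F}

/-- The first jump time admits `s = 0`, whereas ordered points are strictly positive; `h0` removes
the discrepancy. -/
theorem jumpTime_eq_orderedPoint {F : Set (E × E)} {t : ℝ≥0}
    (h0 : (Function.leftLim z t, Function.rightLim z t) ∉ F) (k : ℕ) :
    jumpTime F z t k = orderedPoint (jumpSet F z t) k := by
  induction k with
  | zero => rfl
  | succ k ih =>
    rcases k with _ | k
    · refine iInf_congr fun s => ?_
      congr! 1
      simp only [jumpSet, Set.mem_ofPred_eq, orderedPoint, ENNReal.coe_pos]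
      constructor
      · intro h
        have : 0 < s := pos_iff_ne_zero.2 fun h' => h0 (by simpa [h'] using h)
        exact ⟨⟨this, h⟩, this⟩
      · exact fun h => h.1.2
    · refine iInf_congr fun s => ?_
      congr! 1
      rw [← ih]
      simp only [jumpSet, Set.mem_ofPred_eq]
      constructor
      · exact fun h => ⟨⟨by simpa using (zero_le.trans_lt h.1), h.2⟩, h.1⟩
      · exact fun h => ⟨h.2, h.1.2⟩

/-- Right-continuity and existence of left limits in a discrete state space. -/
structure IsCadlagPath (z : ℝ≥0 → E) : Prop where
  right_continuous : ∀ t, ContinuousWithinAt z (Set.Ioi t) t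
  left_limits : ∀ t, ∃ l : E, Tendsto z (𝓝[<] t) (𝓝 l)

theorem IsCadlagPath.rightLim_eq (hz : IsCadlagPath z) (c : ℝ≥0) :
    Function.rightLim z c = z c :=
  rightLim_eq_of_tendsto (hz.right_continuous c)

theorem IsCadlagPath.eventually_left (hz : IsCadlagPath z) (c : ℝ≥0) :
    ∀ᶠ u in 𝓝[<] c, z u = Function.leftLim z c := by
  have := tendsto_leftLim_of_tendsto (hz.left_limits c)
  rwa [nhds_discrete, tendsto_pure] at this

theorem IsCadlagPath.eventually_right (hz : IsCadlagPath z) (c : ℝ≥0) :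
    ∀ᶠ u in 𝓝[≥] c, z u = z c := by
  have := continuousWithinAt_Ioi_iff_Ici.1 (hz.right_continuous c)
  rwa [ContinuousWithinAt, nhds_discrete, tendsto_pure] at this

theorem IsCadlagPath.exists_ball (hz : IsCadlagPath z) (c : ℝ≥0) :
    ∃ ε > 0, ∀ u ∈ Metric.ball c ε,
      (u < c → z u = Function.leftLim z c) ∧ (c ≤ u → z u = z c) := by
  have h1 := eventually_nhdsWithin_iff.1 (hz.eventually_left c)
  have h2 := eventually_nhdsWithin_iff.1 (hz.eventually_right c)
  exact Metric.eventually_nhds_iff_ball.1 (h1.and h2)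

theorem leftLim_eq_of_exists_ball {c : ℝ≥0} {ε : ℝ} (h : ∀ u ∈ Metric.ball c ε,
      (u < c → z u = Function.leftLim z c) ∧ (c ≤ u → z u = z c))
    {u : ℝ≥0} (hu : u ∈ Metric.ball c ε) (huc : u ≠ c) : Function.leftLim z u = z u := by
  have hb : Metric.ball c ε ∈ 𝓝 u := Metric.isOpen_ball.mem_nhds hu
  refine ContinuousWithinAt.leftLim_eq (ContinuousAt.continuousWithinAt ?_)
  rw [ContinuousAt, nhds_discrete E, tendsto_pure]
  rcases huc.lt_or_gt with hlt | hlt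
  · filter_upwards [hb, gt_mem_nhds hlt] with v hv hvc
    rw [(h v hv).1 hvc, (h u hu).1 hlt]
  · filter_upwards [hb, lt_mem_nhds hlt] with v hv hvc
    rw [(h v hv).2 (le_of_lt hvc), (h u hu).2 hlt.le]

/-- In such a ball the path is constant on either side of `c`, so `c` is its only possible jump. As
`F` avoids the diagonal, both conditions force `u < c ≤ v`. -/
theorem IsCadlagPath.mem_iff_exists_jump (hz : IsCadlagPath z) {F : Set (E × E)}
    (hF : ∀ n, (n, n) ∉ F) {c : ℝ≥0} {ε : ℝ} (h : ∀ u ∈ Metric.ball c ε,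
      (u < c → z u = Function.leftLim z c) ∧ (c ≤ u → z u = z c))
    {u v : ℝ≥0} (hu : u ∈ Metric.ball c ε) (hv : v ∈ Metric.ball c ε) (huv : u < v) :
    (z u, z v) ∈ F ↔
      ∃ s, u < s ∧ s ≤ v ∧ (Function.leftLim z s, Function.rightLim z s) ∈ F := by
  constructor
  · intro hm
    have hne : z u ≠ z v := fun heq => hF _ (heq ▸ hm)
    have huc : u < c := by
      by_contra hcu
      have hcu := not_lt.1 hcu
      exact hne (by rw [(h u hu).2 hcu, (h v hv).2 (hcu.trans huv.le)])
    have hcv : c ≤ v := by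
      by_contra hcv
      have hcv := not_le.1 hcv
      exact hne (by rw [(h u hu).1 huc, (h v hv).1 hcv])
    refine ⟨c, huc, hcv, ?_⟩
    rwa [hz.rightLim_eq, ← (h u hu).1 huc, ← (h v hv).2 hcv]
  · rintro ⟨s, hus, hsv, hs⟩
    have hsb : s ∈ Metric.ball c ε := by
      rw [Metric.mem_ball, NNReal.dist_eq, abs_lt] at hu hv ⊢
      have h1 : (u : ℝ) < s := by exact_mod_cast hus
      have h2 : (s : ℝ) ≤ v := by exact_mod_cast hsv
      constructor <;> linarith [hu.1, hv.2]
    have hsc : s = c := by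
      by_contra hsc
      rw [hz.rightLim_eq, leftLim_eq_of_exists_ball h hsb hsc] at hs
      exact hF _ hs
    subst hsc
    rwa [hz.rightLim_eq, ← (h u hu).1 hus, ← (h v hv).2 hsv] at hs

/-- The Lebesgue number of the cover of `[0, T]` by balls with at most one jump is a mesh below
which sampling detects precisely the jumps in `F`. -/
theorem IsCadlagPath.exists_mesh (hz : IsCadlagPath z) {F : Set (E × E)}
    (hF : ∀ n, (n, n) ∉ F) (T : ℝ≥0) :
    ∃ δ : ℝ≥0, 0 < δ ∧ ∀ u v, u ≤ T → u < v → v < u + δ → ((z u, z v) ∈ F ↔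
      ∃ s, u < s ∧ s ≤ v ∧ (Function.leftLim z s, Function.rightLim z s) ∈ F) := by
  choose ε hε h using hz.exists_ball
  obtain ⟨δ, hδ, hδ'⟩ := lebesgue_number_lemma_of_metric (isCompact_Icc (a := (0 : ℝ≥0)) (b := T))
    (fun c => Metric.isOpen_ball (x := c) (ε := ε c))
    (fun c _ => Set.mem_iUnion.2 ⟨c, Metric.mem_ball_self (hε c)⟩)
  refine ⟨δ.toNNReal, by simpa using hδ, fun u v huT huv hvu => ?_⟩
  obtain ⟨c, hc⟩ := hδ' u ⟨zero_le, huT⟩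
  refine hz.mem_iff_exists_jump hF (h c) (hc (Metric.mem_ball_self hδ)) (hc ?_) huv
  have h1 : (u : ℝ) < v := by exact_mod_cast huv
  have h2 : (v : ℝ) < u + δ := by
    have : (v : ℝ) < ((u + δ.toNNReal : ℝ≥0) : ℝ) := by exact_mod_cast hvu
    rwa [NNReal.coe_add, Real.coe_toNNReal _ hδ.le] at this
  rw [Metric.mem_ball, NNReal.dist_eq, abs_lt]
  constructor <;> linarith

theorem IsCadlagPath.eventually_notMem_jumpSet (hz : IsCadlagPath z) {F : Set (E × E)}
    (hF : ∀ n, (n, n) ∉ F) (t b : ℝ≥0) : ∀ᶠ s in 𝓝[>] b, s ∉ jumpSet F z t := by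
  obtain ⟨ε, hε, h⟩ := hz.exists_ball (t + b)
  have h1 : ∀ᶠ s in 𝓝 b, t + s ∈ Metric.ball (t + b) ε :=
    (continuous_const.add continuous_id).continuousAt.eventually (Metric.ball_mem_nhds _ hε)
  filter_upwards [nhdsWithin_le_nhds h1, self_mem_nhdsWithin] with s hs hbs hmem
  have hne : t + s ≠ t + b := fun heq => (ne_of_gt hbs) (add_left_cancel heq)
  have := hmem.2
  rw [hz.rightLim_eq, leftLim_eq_of_exists_ball h hs hne] at this
  exact hF _ this

theorem IsCadlagPath.tendsto_orderedPoint_gridJumps (hz : IsCadlagPath z) {F : Set (E × E)}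
    (hF : ∀ n, (n, n) ∉ F) (t : ℝ≥0) {ι : Type*} {l : Filter ι} {η : ι → ℝ≥0}
    (hη : Tendsto η l (𝓝[>] 0)) (k : ℕ) :
    Tendsto (fun j => orderedPoint (gridJumps F (η j) fun i => z (t + i * η j)) k) l
      (𝓝 (orderedPoint (jumpSet F z t) k)) := by
  refine tendsto_orderedPoint_grid hη (fun s hs => hs.1)
    (hz.eventually_notMem_jumpSet hF t) ?_ ?_ k
  · rintro j s ⟨i, -, hi⟩
    exact ⟨i, hi⟩
  · intro T
    obtain ⟨δ, hδ, h⟩ := hz.exists_mesh hF (t + T)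
    have hpos : ∀ᶠ j in l, 0 < η j := hη.eventually self_mem_nhdsWithin
    have hsmall : ∀ᶠ j in l, η j < δ :=
      (tendsto_nhds_of_tendsto_nhdsWithin hη).eventually (gt_mem_nhds hδ)
    filter_upwards [hpos, hsmall] with j hj0 hjδ i hi
    have hmem : (((i : ℝ≥0) + 1) * η j ∈ gridJumps F (η j) fun i => z (t + i * η j)) ↔
        (z (t + i * η j), z (t + (i + 1) * η j)) ∈ F := by
      constructor
      · rintro ⟨i', hi', heq⟩
        have : (i : ℝ≥0) + 1 = i' + 1 := mul_right_cancel₀ hj0.ne' heq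
        have : i = i' := by exact_mod_cast add_right_cancel this
        subst this
        simpa using hi'
      · exact fun hm => ⟨i, by simpa using hm, rfl⟩
    have hle : (i : ℝ≥0) * η j ≤ (i + 1) * η j := by gcongr; exact le_self_add
    rw [hmem, h _ _ (by gcongr; exact hle.trans hi)]
    · constructor
      · rintro ⟨s, h1, h2, h3⟩
        have hts : t ≤ s := le_self_add.trans h1.le
        refine ⟨s - t, ⟨tsub_pos_of_lt (le_self_add.trans_lt h1), ?_⟩, ?_, ?_⟩
        · rwa [add_tsub_cancel_of_le hts]
        · exact lt_tsub_iff_left.2 h1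
        · exact tsub_le_iff_left.2 h2
      · rintro ⟨s, ⟨-, h3⟩, h1, h2⟩
        exact ⟨t + s, by gcongr, by gcongr, h3⟩
    · gcongr; exact lt_add_one _
    · rw [add_mul, one_mul, ← add_assoc]; gcongr

end Paths

/-! ### The function `e^{-θy}` on `[0, ∞]`. -/

theorem expNeg_zero (θ : ℂ) : expNeg θ 0 = 1 := by simp [expNeg]

theorem expNeg_coe (θ : ℂ) (y : ℝ≥0) : expNeg θ y = Complex.exp (-θ * (y : ℝ)) := by
  simp [expNeg]

theorem expNeg_coe_add (θ : ℂ) (h : ℝ≥0) (y : ℝ≥0∞) :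
    expNeg θ (h + y) = Complex.exp (-θ * (h : ℝ)) * expNeg θ y := by
  by_cases hy : y = ∞
  · simp [expNeg, hy]
  · lift y to ℝ≥0 using hy
    rw [← ENNReal.coe_add, expNeg_coe, expNeg_coe, ← Complex.exp_add]
    congr 1
    push_cast
    ring

theorem norm_exp_neg_mul (θ : ℂ) (y : ℝ≥0) :
    ‖Complex.exp (-θ * (y : ℝ))‖ = Real.exp (-θ.re * y) := by
  simp [Complex.norm_exp]

theorem norm_expNeg_le_one {θ : ℂ} (hθ : 0 ≤ θ.re) (y : ℝ≥0∞) : ‖expNeg θ y‖ ≤ 1 := by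
  by_cases hy : y = ∞
  · simp [expNeg, hy]
  · lift y to ℝ≥0 using hy
    rw [expNeg_coe, norm_exp_neg_mul, Real.exp_le_one_iff]
    nlinarith [y.2, mul_nonneg hθ y.2]

theorem continuous_expNeg {θ : ℂ} (hθ : 0 < θ.re) : Continuous (expNeg θ) := by
  rw [continuous_iff_continuousAt]
  intro y
  by_cases hy : y = ∞
  · subst hy
    rw [ContinuousAt, show expNeg θ ∞ = 0 by simp [expNeg], Metric.tendsto_nhds]
    intro ε hε
    have h1 : Tendsto (fun y : ℝ => Real.exp (-θ.re * y)) atTop (𝓝 0) :=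
      Real.tendsto_exp_atBot.comp ((tendsto_id.const_mul_atTop_of_neg (neg_lt_zero.2 hθ)))
    obtain ⟨T, hT⟩ := eventually_atTop.1 (h1.eventually (gt_mem_nhds hε))
    filter_upwards [lt_mem_nhds (ENNReal.coe_lt_top (r := T.toNNReal))] with y hy
    rw [dist_zero_right]
    by_cases hy' : y = ∞
    · simpa [expNeg, hy'] using hε
    · lift y to ℝ≥0 using hy'
      rw [expNeg_coe, norm_exp_neg_mul]
      have : T.toNNReal < y := by exact_mod_cast hy
      exact hT _ (Real.toNNReal_le_iff_le_coe.1 this.le)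
  · have h1 : ContinuousAt (fun y : ℝ≥0∞ => Complex.exp (-θ * (y.toReal : ℂ))) y := by
      have := ENNReal.continuousAt_toReal hy
      fun_prop
    refine h1.congr ?_
    filter_upwards [gt_mem_nhds (lt_top_iff_ne_top.2 hy)] with u hu
    simp [expNeg, hu.ne]

/-! ### First-step analysis for the discrete skeleton. -/

section Truncation

variable {S : Type*}

open Classical in
/-- `r ^ W`, where `W` is the number of steps up to and including the `k`-th transition in `F` of
the sequence, provided that `W ≤ N`; and `0` otherwise. -/
noncomputable def truncExp (F : Set (S × S)) (r : ℂ) : ℕ → ℕ → (ℕ → S) → ℂ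
  | _, 0, _ => 1
  | 0, _ + 1, _ => 0
  | N + 1, k + 1, x =>
    r * truncExp F r N (if (x 0, x 1) ∈ F then k else k + 1) fun i => x (i + 1)

open Classical in
/-- The mean of `truncExp F r N k` for a Markov sequence with transition matrix `q`. -/
noncomputable def truncMean (F : Set (S × S)) (r : ℂ) (q : S → S → ℝ) : ℕ → ℕ → S → ℂ
  | _, 0, _ => 1
  | 0, _ + 1, _ => 0
  | N + 1, k + 1, n =>
    r * ∑' n', (q n n' : ℂ) * truncMean F r q N (if (n, n') ∈ F then k else k + 1) n'

theorem norm_truncExp_le_one (F : Set (S × S)) {r : ℂ} (hr : ‖r‖ ≤ 1) (N k : ℕ) (x : ℕ → S) :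
    ‖truncExp F r N k x‖ ≤ 1 := by
  induction N generalizing k x with
  | zero => rcases k with _ | k <;> simp [truncExp]
  | succ N ih =>
    rcases k with _ | k
    · simp [truncExp]
    · rw [truncExp, norm_mul]
      exact mul_le_one₀ hr (norm_nonneg _) (ih _ _)

/-- Both terms satisfy the same one-step recursion with factor `r`; after `N` steps at most a
quantity of norm one remains. Truncation leaves a functional of finitely many coordinates,
accessible to induction. -/
theorem norm_expNeg_sub_truncExp_le (F : Set (S × S)) {θ : ℂ} (hθ : 0 ≤ θ.re) {h : ℝ≥0}
    (hh : 0 < h) (N k : ℕ) (x : ℕ → S) :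
    ‖expNeg θ (orderedPoint (gridJumps F h x) k) -
      truncExp F (Complex.exp (-θ * (h : ℝ))) N k x‖ ≤ ‖Complex.exp (-θ * (h : ℝ))‖ ^ N := by
  induction N generalizing k x with
  | zero =>
    rcases k with _ | k
    · simp [truncExp, orderedPoint, expNeg_zero]
    · simpa [truncExp] using norm_expNeg_le_one hθ _
  | succ N ih =>
    rcases k with _ | k
    · simp only [orderedPoint, expNeg_zero, truncExp, sub_self, norm_zero]; positivity
    · rw [orderedPoint_gridJumps_succ F hh, expNeg_coe_add, truncExp, ← mul_sub, norm_mul, pow_succ']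
      gcongr
      exact ih _ _

theorem measurable_truncExp [MeasurableSpace S] [Countable S] [MeasurableSingletonClass S]
    (F : Set (S × S)) (r : ℂ) (N k : ℕ) : Measurable (truncExp F r N k) := by
  induction N generalizing k with
  | zero =>
    rcases k with _ | k
    · exact measurable_const' fun x y => by simp [truncExp]
    · exact measurable_const' fun x y => by simp [truncExp]
  | succ N ih =>
    rcases k with _ | k
    · exact measurable_const' fun x y => by simp [truncExp]
    · classical
      have hs : Measurable fun (x : ℕ → S) (i : ℕ) => x (i + 1) := by fun_prop
      have h2 : MeasurableSet {x : ℕ → S | (x 0, x 1) ∈ F} :=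
        (Measurable.prodMk (measurable_pi_apply 0) (measurable_pi_apply 1))
          F.to_countable.measurableSet
      have : truncExp F r (N + 1) (k + 1) = fun x => if (x 0, x 1) ∈ F
          then r * truncExp F r N k (fun i => x (i + 1))
          else r * truncExp F r N (k + 1) (fun i => x (i + 1)) := by
        ext x
        rw [truncExp]
        split_ifs <;> rfl
      rw [this]
      exact Measurable.ite h2 (((ih k).comp hs).const_mul r) (((ih (k + 1)).comp hs).const_mul r)

theorem summable_mul_of_norm_le_one {a : S → ℝ} (ha : ∀ i, 0 ≤ a i) (hs : Summable a)
    {b : S → ℂ} (hb : ∀ i, ‖b i‖ ≤ 1) : Summable fun i => (a i : ℂ) * b i := by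
  refine Summable.of_norm_bounded hs fun i => ?_
  rw [norm_mul, Complex.norm_of_nonneg (ha i)]
  exact mul_le_of_le_one_right (ha i) (hb i)

theorem norm_tsum_mul_le {a : S → ℝ} (ha : ∀ i, 0 ≤ a i) (hs : HasSum a 1)
    {b : S → ℂ} {c : ℝ} (hb : ∀ i, ‖b i‖ ≤ c) : ‖∑' i, (a i : ℂ) * b i‖ ≤ c := by
  refine tsum_of_norm_bounded (g := fun i => a i * c) (by simpa using hs.mul_right c) fun i => ?_
  rw [norm_mul, Complex.norm_of_nonneg (ha i)]
  exact mul_le_mul_of_nonneg_left (hb i) (ha i)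

variable (F : Set (S × S)) {r : ℂ} {q : S → S → ℝ}

theorem norm_truncMean_le_one (hr : ‖r‖ ≤ 1) (hq : ∀ i j, 0 ≤ q i j) (hq1 : ∀ i, HasSum (q i) 1)
    (N k : ℕ) (n : S) : ‖truncMean F r q N k n‖ ≤ 1 := by
  induction N generalizing k n with
  | zero => rcases k with _ | k <;> simp [truncMean]
  | succ N ih =>
    rcases k with _ | k
    · simp [truncMean]
    · rw [truncMean, norm_mul]
      exact mul_le_one₀ hr (norm_nonneg _) (norm_tsum_mul_le (hq n) (hq1 n) fun _ => ih _ _)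

theorem norm_truncMean_sub_le (hr : ‖r‖ ≤ 1) (hq : ∀ i j, 0 ≤ q i j)
    (hq1 : ∀ i, HasSum (q i) 1) (N k : ℕ) (n : S) :
    ‖truncMean F r q N k n - truncMean F r q (N + 1) k n‖ ≤ ‖r‖ ^ N := by
  induction N generalizing k n with
  | zero =>
    rcases k with _ | k
    · simp [truncMean]
    · have := norm_truncMean_le_one F hr hq hq1 1 (k + 1) n
      simpa [truncMean.eq_2] using this
  | succ N ih =>
    rcases k with _ | k
    · simp only [truncMean, sub_self, norm_zero]; positivity
    · rw [truncMean, truncMean, ← mul_sub, norm_mul, pow_succ',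
        ← Summable.tsum_sub
          (summable_mul_of_norm_le_one (hq n) (hq1 n).summable
            fun _ => norm_truncMean_le_one F hr hq hq1 _ _ _)
          (summable_mul_of_norm_le_one (hq n) (hq1 n).summable
            fun _ => norm_truncMean_le_one F hr hq hq1 _ _ _)]
      simp_rw [← mul_sub]
      gcongr
      exact norm_tsum_mul_le (hq n) (hq1 n) fun _ => ih _ _

/-- The mean of `r ^ W`, where `W` is the number of steps up to and including the `k`-th transition
in `F` of a Markov sequence with transition matrix `q`. -/
noncomputable def gridMean (F : Set (S × S)) (r : ℂ) (q : S → S → ℝ) (k : ℕ) (n : S) : ℂ :=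
  limUnder atTop fun N => truncMean F r q N k n

theorem tendsto_truncMean (hr : ‖r‖ < 1) (hq : ∀ i j, 0 ≤ q i j) (hq1 : ∀ i, HasSum (q i) 1)
    (k : ℕ) (n : S) :
    Tendsto (fun N => truncMean F r q N k n) atTop (𝓝 (gridMean F r q k n)) := by
  refine (cauchySeq_of_le_geometric ‖r‖ 1 hr fun N => ?_).tendsto_limUnder
  rw [dist_eq_norm, one_mul]
  exact norm_truncMean_sub_le F hr.le hq hq1 N k n

theorem norm_gridMean_le_one (hr : ‖r‖ < 1) (hq : ∀ i j, 0 ≤ q i j) (hq1 : ∀ i, HasSum (q i) 1)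
    (k : ℕ) (n : S) : ‖gridMean F r q k n‖ ≤ 1 :=
  le_of_tendsto (tendsto_truncMean F hr hq hq1 k n).norm
    (Eventually.of_forall fun N => norm_truncMean_le_one F hr.le hq hq1 N k n)

-- The truncated recursion passes to the limit `N → ∞` by dominated convergence against the row `q
-- n`.
open Classical in
theorem gridMean_succ (hr : ‖r‖ < 1) (hq : ∀ i j, 0 ≤ q i j) (hq1 : ∀ i, HasSum (q i) 1)
    (k : ℕ) (n : S) : gridMean F r q (k + 1) n =
      r * ∑' n', (q n n' : ℂ) * gridMean F r q (if (n, n') ∈ F then k else k + 1) n' := by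
  refine tendsto_nhds_unique
    ((tendsto_truncMean F hr hq hq1 (k + 1) n).comp (tendsto_add_atTop_nat 1)) ?_
  simp only [Function.comp_def, truncMean]
  refine (tendsto_tsum_of_dominated_convergence (bound := q n) (hq1 n).summable
    (fun n' => (tendsto_truncMean F hr hq hq1 _ n').const_mul _) ?_).const_mul r
  refine Eventually.of_forall fun N n' => ?_
  rw [norm_mul, Complex.norm_of_nonneg (hq _ _)]
  exact mul_le_of_le_one_right (hq _ _) (norm_truncMean_le_one F hr.le hq hq1 _ _ _)

end Truncation

/-! ### Skeleton expectations from the Markov property. -/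

section MarkovChain

/-- The past `σ(Z u, u ≤ t)` of a process. -/
abbrev past {Ω : Type*} {E : Set ℕ} (Z : ℝ≥0 → Ω → E) (t : ℝ≥0) : MeasurableSpace Ω :=
  ⨆ u : Set.Iic t, MeasurableSpace.comap (Z u) inferInstance

theorem past_mono {Ω : Type*} {E : Set ℕ} (Z : ℝ≥0 → Ω → E) {s t : ℝ≥0} (hst : s ≤ t) : past Z s ≤ past Z t :=
  iSup_le fun u => le_iSup (fun u : Set.Iic t => MeasurableSpace.comap (Z u) inferInstance)
    ⟨u, u.2.trans hst⟩

theorem measurableSet_past {Ω : Type*} {E : Set ℕ} (Z : ℝ≥0 → Ω → E) (t : ℝ≥0) (n : E) :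
    MeasurableSet[past Z t] (Z t ⁻¹' {n}) :=
  le_iSup (fun u : Set.Iic t => MeasurableSpace.comap (Z u) inferInstance) ⟨t, Set.self_mem_Iic⟩ _
    ⟨{n}, measurableSet_singleton n, rfl⟩

variable {Ω : Type*} [MeasurableSpace Ω] {P : Measure Ω} {E : Set ℕ}
  {Z : ℝ≥0 → Ω → E} {p : ℝ≥0 → E → E → ℝ} {Q : E → E → ℝ}

theorem IsMarkovChain.isCadlagPath (hZ : IsMarkovChain P Z p) (ω : Ω) :
    IsCadlagPath fun u => Z u ω :=
  ⟨hZ.right_continuous ω, hZ.left_limits ω⟩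

theorem IsMarkovChain.past_le (hZ : IsMarkovChain P Z p) (t : ℝ≥0) :
    past Z t ≤ ‹MeasurableSpace Ω› :=
  iSup_le fun u => (hZ.measurable u).comap_le

theorem IsMarkovChain.measurable_truncExp (hZ : IsMarkovChain P Z p) (F : Set (E × E)) (r : ℂ)
    (N k : ℕ) (t h : ℝ≥0) : Measurable fun ω => truncExp F r N k fun i => Z (t + i * h) ω :=
  (_root_.measurable_truncExp F r N k).comp (measurable_pi_lambda _ fun _ => hZ.measurable _)

/-- The arbitrary past event `A` makes the induction close: after one step, `A ∩ {Z t = n}` is a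
past event for time `t + h`, and the Markov property produces the factor `p h n n'`. -/
theorem setIntegral_truncExp [IsProbabilityMeasure P] (hZ : IsMarkovChain P Z p)
    (F : Set (E × E)) {r : ℂ} (hr : ‖r‖ ≤ 1) (h : ℝ≥0) (N k : ℕ) (t : ℝ≥0) (n : E) (A : Set Ω)
    (hA : MeasurableSet[past Z t] A) :
    ∫ ω in A ∩ Z t ⁻¹' {n}, truncExp F r N k (fun i => Z (t + i * h) ω) ∂P =
      (P.real (A ∩ Z t ⁻¹' {n}) : ℂ) * truncMean F r (p h) N k n := by
  induction N generalizing k t n A with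
  | zero => rcases k with _ | k <;> simp [truncExp, truncMean]
  | succ N ih =>
    rcases k with _ | k
    · simp [truncExp, truncMean]
    classical
    set B := A ∩ Z t ⁻¹' {n} with hB
    have hBpast : MeasurableSet[past Z (t + h)] B :=
      past_mono Z le_self_add _ (MeasurableSet.inter hA (measurableSet_past Z t n))
    have hBm : MeasurableSet B := hZ.past_le _ _ hBpast
    have hm : ∀ n', MeasurableSet (B ∩ Z (t + h) ⁻¹' {n'}) := fun n' =>
      hBm.inter (hZ.measurable _ (measurableSet_singleton n'))
    have hU : B = ⋃ n', B ∩ Z (t + h) ⁻¹' {n'} := by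
      ext ω; simp
    have hd : Pairwise (Function.onFun Disjoint fun n' => B ∩ Z (t + h) ⁻¹' {n'}) := by
      intro i j hij
      refine Set.disjoint_left.2 fun ω h1 h2 => hij ?_
      rw [← h1.2, ← h2.2]
    have hint : Integrable (fun ω => truncExp F r (N + 1) (k + 1) fun i => Z (t + i * h) ω) P :=
      Integrable.of_bound (hZ.measurable_truncExp F r _ _ t h).aestronglyMeasurable 1
        (Eventually.of_forall fun ω => norm_truncExp_le_one F hr _ _ _)
    have h1 : ∀ n', ∫ ω in B ∩ Z (t + h) ⁻¹' {n'},
        truncExp F r (N + 1) (k + 1) (fun i => Z (t + i * h) ω) ∂P =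
        (P.real B : ℂ) * r * ((p h n n' : ℂ) *
          truncMean F r (p h) N (if (n, n') ∈ F then k else k + 1) n') := by
      intro n'
      have h2 : ∫ ω in B ∩ Z (t + h) ⁻¹' {n'},
          truncExp F r (N + 1) (k + 1) (fun i => Z (t + i * h) ω) ∂P =
          ∫ ω in B ∩ Z (t + h) ⁻¹' {n'}, r * truncExp F r N (if (n, n') ∈ F then k else k + 1)
            (fun i => Z (t + h + i * h) ω) ∂P := by
        refine setIntegral_congr_fun (hm n') fun ω hω => ?_
        have e1 : Z t ω = n := hω.1.2
        have e2 : Z (t + h) ω = n' := hω.2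
        have e3 : ∀ i : ℕ, t + ((i : ℝ≥0) + 1) * h = t + h + i * h := fun i => by ring
        simp only [truncExp, Nat.cast_zero, Nat.cast_one, zero_mul, one_mul, add_zero, e1, e2,
          Nat.cast_add, e3]
      rw [h2, integral_const_mul, ih _ _ _ _ hBpast, hB, hZ.markov t h n n' A hA]
      push_cast
      ring
    conv_lhs => rw [hU]
    rw [integral_iUnion hm hd hint.integrableOn]
    simp_rw [h1]
    rw [tsum_mul_left, truncMean, mul_assoc]

theorem norm_exp_neg_mul_lt_one {θ : ℂ} (hθ : 0 < θ.re) {h : ℝ≥0} (hh : 0 < h) :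
    ‖Complex.exp (-θ * (h : ℝ))‖ < 1 := by
  rw [norm_exp_neg_mul, Real.exp_lt_one_iff]
  have : (0 : ℝ) < h := hh
  nlinarith [mul_pos hθ this]

theorem tendsto_truncExp {S : Type*} (F : Set (S × S)) {θ : ℂ} (hθ : 0 < θ.re) {h : ℝ≥0}
    (hh : 0 < h) (k : ℕ) (x : ℕ → S) :
    Tendsto (fun N => truncExp F (Complex.exp (-θ * (h : ℝ))) N k x) atTop
      (𝓝 (expNeg θ (orderedPoint (gridJumps F h x) k))) := by
  rw [tendsto_iff_norm_sub_tendsto_zero]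
  refine squeeze_zero (fun _ => norm_nonneg _) (fun N => ?_)
    (tendsto_pow_atTop_nhds_zero_of_lt_one (norm_nonneg _) (norm_exp_neg_mul_lt_one hθ hh))
  rw [norm_sub_rev]
  exact norm_expNeg_sub_truncExp_le F hθ.le hh N k x

theorem IsMarkovChain.measurable_expNeg_grid (hZ : IsMarkovChain P Z p) (F : Set (E × E))
    {θ : ℂ} (hθ : 0 < θ.re) {h : ℝ≥0} (hh : 0 < h) (k : ℕ) (t : ℝ≥0) :
    Measurable fun ω =>
      expNeg θ (orderedPoint (gridJumps F h fun i => Z (t + i * h) ω) k) :=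
  measurable_of_tendsto_metrizable (fun N => hZ.measurable_truncExp F _ N k t h)
    (tendsto_pi_nhds.2 fun _ => tendsto_truncExp F hθ hh k _)

theorem setIntegral_expNeg_grid [IsProbabilityMeasure P] (hp : IsTransitionFunction p)
    (hZ : IsMarkovChain P Z p) (F : Set (E × E)) {θ : ℂ} (hθ : 0 < θ.re) {h : ℝ≥0} (hh : 0 < h)
    (k : ℕ) (t : ℝ≥0) (n : E) :
    ∫ ω in Z t ⁻¹' {n}, expNeg θ (orderedPoint (gridJumps F h fun i => Z (t + i * h) ω) k) ∂P =
      (P.real (Z t ⁻¹' {n}) : ℂ) * gridMean F (Complex.exp (-θ * (h : ℝ))) (p h) k n := by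
  have hr := norm_exp_neg_mul_lt_one hθ hh
  refine tendsto_nhds_unique (tendsto_integral_of_dominated_convergence (fun _ => (1 : ℝ))
    (fun N => (hZ.measurable_truncExp F (Complex.exp (-θ * (h : ℝ))) N k t h).aestronglyMeasurable)
    (integrable_const 1)
    (fun N => Eventually.of_forall fun ω => norm_truncExp_le_one F hr.le _ _ _)
    (Eventually.of_forall fun ω => tendsto_truncExp F hθ hh k _)) ?_
  refine ((tendsto_truncMean F hr (hp.nonneg h) (hp.hasSum_one h) k n).const_mul _).congr
    fun N => ?_
  have := setIntegral_truncExp hZ F hr.le h N k t n Set.univ MeasurableSet.univ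
  rw [Set.univ_inter] at this
  exact this.symm

/-! ### Refining the grid. -/

/-- Step sizes decreasing to zero. -/
noncomputable def mesh (m : ℕ) : ℝ≥0 := 1 / ((m : ℝ≥0) + 1)

theorem mesh_pos (m : ℕ) : 0 < mesh m := by unfold mesh; positivity

theorem tendsto_mesh : Tendsto mesh atTop (𝓝[>] 0) :=
  tendsto_nhdsWithin_iff.2 ⟨tendsto_one_div_add_atTop_nhds_zero_nat,
    Eventually.of_forall mesh_pos⟩

theorem tendsto_coe_mesh : Tendsto (fun m => (mesh m : ℝ)) atTop (𝓝 0) := by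
  rw [← NNReal.coe_zero, NNReal.tendsto_coe]
  exact tendsto_nhds_of_tendsto_nhdsWithin tendsto_mesh

theorem tendsto_ofReal_mesh : Tendsto (fun m => ((mesh m : ℝ) : ℂ)) atTop (𝓝 0) := by
  rw [← Complex.ofReal_zero]
  exact (Complex.continuous_ofReal.tendsto _).comp tendsto_coe_mesh

theorem tendsto_transition_of_ne (hQ : HasTransitionRates p Q) {i j : E} (hij : i ≠ j) :
    Tendsto (fun m => p (mesh m) i j) atTop (𝓝 0) := by
  have h1 := (hQ.tendsto_rate i j hij).comp tendsto_mesh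
  have h3 := h1.mul tendsto_coe_mesh
  rw [mul_zero] at h3
  refine h3.congr fun m => ?_
  have : (mesh m : ℝ) ≠ 0 := by exact_mod_cast (mesh_pos m).ne'
  simp only [Function.comp_apply]
  field_simp

/-- A jump from `i` to `j` at the fixed time `t` forces `Z (t - h) = i`, `Z t = j` for all small
mesh sizes `h`, an event of probability at most `p h i j → 0`. -/
theorem ae_leftLim_eq [IsProbabilityMeasure P] (hQ : HasTransitionRates p Q)
    (hp : IsTransitionFunction p) (hZ : IsMarkovChain P Z p) (t : ℝ≥0) :
    ∀ᵐ ω ∂P, Function.leftLim (fun u => Z u ω) t = Z t ω := by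
  rcases eq_or_ne t 0 with rfl | ht
  · exact Eventually.of_forall fun ω => leftLim_eq_of_isBot fun _ => zero_le
  have ht : 0 < t := pos_iff_ne_zero.2 ht
  have hmesh : Tendsto (fun m => t - mesh m) atTop (𝓝[<] t) := by
    refine tendsto_nhdsWithin_iff.2 ⟨?_, Eventually.of_forall fun m => tsub_lt_self ht (mesh_pos m)⟩
    simpa using tendsto_const_nhds.sub (tendsto_nhds_of_tendsto_nhdsWithin tendsto_mesh)
  have key : ∀ i j : E, i ≠ j → ∀ M : ℕ,
      P (⋂ m ≥ M, Z (t - mesh m) ⁻¹' {i} ∩ Z t ⁻¹' {j}) = 0 := by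
    intro i j hij M
    rw [← measureReal_eq_zero_iff]
    refine le_antisymm (ge_of_tendsto (tendsto_transition_of_ne hQ hij) ?_) measureReal_nonneg
    filter_upwards [eventually_ge_atTop M,
      (tendsto_nhds_of_tendsto_nhdsWithin tendsto_mesh).eventually (gt_mem_nhds ht)] with m hm hmt
    have h1 := hZ.markov (t - mesh m) (mesh m) i j Set.univ MeasurableSet.univ
    rw [Set.univ_inter, tsub_add_cancel_of_le (le_of_lt hmt)] at h1
    calc P.real (⋂ m ≥ M, Z (t - mesh m) ⁻¹' {i} ∩ Z t ⁻¹' {j})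
        ≤ P.real (Z (t - mesh m) ⁻¹' {i} ∩ Z t ⁻¹' {j}) :=
          measureReal_mono (Set.biInter_subset_of_mem hm)
      _ = P.real (Z (t - mesh m) ⁻¹' {i}) * p (mesh m) i j := h1
      _ ≤ p (mesh m) i j := mul_le_of_le_one_left (hp.nonneg _ _ _) measureReal_le_one
  have hae : ∀ᵐ ω ∂P, ∀ i j : E, i ≠ j → ∀ M : ℕ,
      ω ∉ ⋂ m ≥ M, Z (t - mesh m) ⁻¹' {i} ∩ Z t ⁻¹' {j} := by
    simp only [ae_all_iff]
    exact fun i j hij M => measure_eq_zero_iff_ae_notMem.1 (key i j hij M)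
  filter_upwards [hae] with ω hω
  by_contra hne
  obtain ⟨M, hM⟩ := eventually_atTop.1
    (hmesh.eventually ((hZ.isCadlagPath ω).eventually_left t))
  refine hω _ _ hne M (Set.mem_iInter₂.2 fun m hm => ⟨hM m hm, rfl⟩)

theorem HasTransitionRates.diagonal_notMem (hQ : HasTransitionRates p Q) {F : Set (E × E)}
    (hF : ∀ n n', (n, n') ∈ F → 0 < Q n n') (n : E) : (n, n) ∉ F := fun h =>
  (hF n n h).ne' (hQ.rate_self n)

theorem ae_tendsto_expNeg_grid [IsProbabilityMeasure P] (hp : IsTransitionFunction p)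
    (hQ : HasTransitionRates p Q) (hZ : IsMarkovChain P Z p) {F : Set (E × E)}
    (hF : ∀ n, (n, n) ∉ F) {θ : ℂ} (hθ : 0 < θ.re) (k : ℕ) (t : ℝ≥0) :
    ∀ᵐ ω ∂P, Tendsto (fun m => expNeg θ
        (orderedPoint (gridJumps F (mesh m) fun i => Z (t + i * mesh m) ω) k)) atTop
      (𝓝 (expNeg θ (jumpTime F (fun u => Z u ω) t k))) := by
  filter_upwards [ae_leftLim_eq hQ hp hZ t] with ω hω
  rw [jumpTime_eq_orderedPoint (by rw [(hZ.isCadlagPath ω).rightLim_eq, hω]; exact hF _)]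
  exact ((continuous_expNeg hθ).tendsto _).comp
    ((hZ.isCadlagPath ω).tendsto_orderedPoint_gridJumps hF t tendsto_mesh k)

/-- The jump time is an uncountable infimum; measurability comes from the grid approximations. -/
theorem aestronglyMeasurable_expNeg_of_pos [IsProbabilityMeasure P] (hp : IsTransitionFunction p)
    (hQ : HasTransitionRates p Q) (hZ : IsMarkovChain P Z p) {F : Set (E × E)}
    (hF : ∀ n, (n, n) ∉ F) {θ : ℂ} (hθ : 0 < θ.re) (k : ℕ) (t : ℝ≥0) :
    AEStronglyMeasurable (fun ω => expNeg θ (jumpTime F (fun u => Z u ω) t k)) P :=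
  aestronglyMeasurable_of_tendsto_ae atTop
    (fun m => (hZ.measurable_expNeg_grid F hθ (mesh_pos m) k t).aestronglyMeasurable)
    (ae_tendsto_expNeg_grid hp hQ hZ hF hθ k t)

theorem tendsto_expNeg_add_mesh (θ : ℂ) (y : ℝ≥0∞) :
    Tendsto (fun m => expNeg (θ + (mesh m : ℝ)) y) atTop (𝓝 (expNeg θ y)) := by
  have hc : Continuous fun θ => expNeg θ y := by
    unfold expNeg
    split_ifs <;> fun_prop
  have h3 : Tendsto (fun m => θ + ((mesh m : ℝ) : ℂ)) atTop (𝓝 θ) := by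
    simpa using tendsto_ofReal_mesh.const_add θ
  exact (hc.tendsto θ).comp h3

theorem aestronglyMeasurable_expNeg [IsProbabilityMeasure P] (hp : IsTransitionFunction p)
    (hQ : HasTransitionRates p Q) (hZ : IsMarkovChain P Z p) {F : Set (E × E)}
    (hF : ∀ n, (n, n) ∉ F) {θ : ℂ} (hθ : 0 ≤ θ.re) (k : ℕ) (t : ℝ≥0) :
    AEStronglyMeasurable (fun ω => expNeg θ (jumpTime F (fun u => Z u ω) t k)) P :=
  aestronglyMeasurable_of_tendsto_ae atTop
    (fun m => aestronglyMeasurable_expNeg_of_pos hp hQ hZ hF (θ := θ + (mesh m : ℝ))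
      (by simpa using add_pos_of_nonneg_of_pos hθ (NNReal.coe_pos.2 (mesh_pos m))) k t)
    (Eventually.of_forall fun _ => tendsto_expNeg_add_mesh θ _)

theorem integrable_expNeg [IsProbabilityMeasure P] (hp : IsTransitionFunction p)
    (hQ : HasTransitionRates p Q) (hZ : IsMarkovChain P Z p) {F : Set (E × E)}
    (hF : ∀ n, (n, n) ∉ F) {θ : ℂ} (hθ : 0 ≤ θ.re) (k : ℕ) (t : ℝ≥0) (n : E) :
    Integrable (fun ω => expNeg θ (jumpTime F (fun u => Z u ω) t k)) (P[|Z t ⁻¹' {n}]) :=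
  Integrable.of_bound ((aestronglyMeasurable_expNeg hp hQ hZ hF hθ k t).mono_ac
    cond_absolutelyContinuous) 1 (Eventually.of_forall fun _ => norm_expNeg_le_one hθ _)

theorem condLST_eq (F : Set (E × E)) (t : ℝ≥0) (k : ℕ) (θ : ℂ) (n : E) :
    condLST P Z F t k θ n = (P.real (Z t ⁻¹' {n}) : ℂ)⁻¹ *
      ∫ ω in Z t ⁻¹' {n}, expNeg θ (jumpTime F (fun u => Z u ω) t k) ∂P := by
  rw [condLST, ProbabilityTheory.cond, integral_smul_measure, ENNReal.toReal_inv,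
    Complex.real_smul, Complex.ofReal_inv]
  rfl

theorem norm_condLST_le_one [IsProbabilityMeasure P] (F : Set (E × E)) (t : ℝ≥0) (k : ℕ) {θ : ℂ}
    (hθ : 0 ≤ θ.re) (n : E) (hn : P (Z t ⁻¹' {n}) ≠ 0) : ‖condLST P Z F t k θ n‖ ≤ 1 := by
  have := cond_isProbabilityMeasure hn
  refine (norm_integral_le_of_norm_le_const
    (Eventually.of_forall fun _ => norm_expNeg_le_one hθ _)).trans ?_
  simp

theorem condLST_zero [IsProbabilityMeasure P] (F : Set (E × E)) (t : ℝ≥0) (θ : ℂ) (n : E)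
    (hn : P (Z t ⁻¹' {n}) ≠ 0) : condLST P Z F t 0 θ n = 1 := by
  have := cond_isProbabilityMeasure hn
  simp [condLST, jumpTime, expNeg_zero]

theorem tendsto_gridMean_condLST [IsProbabilityMeasure P] (hp : IsTransitionFunction p)
    (hQ : HasTransitionRates p Q) (hZ : IsMarkovChain P Z p) {F : Set (E × E)}
    (hF : ∀ n, (n, n) ∉ F) {θ : ℂ} (hθ : 0 < θ.re) (k : ℕ) (t : ℝ≥0) (n : E)
    (hn : P (Z t ⁻¹' {n}) ≠ 0) :
    Tendsto (fun m => gridMean F (Complex.exp (-θ * (mesh m : ℝ))) (p (mesh m)) k n) atTop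
      (𝓝 (condLST P Z F t k θ n)) := by
  have h1 := tendsto_integral_of_dominated_convergence (μ := P.restrict (Z t ⁻¹' {n}))
    (fun _ => (1 : ℝ))
    (fun m => (hZ.measurable_expNeg_grid F hθ (mesh_pos m) k t).aestronglyMeasurable)
    (integrable_const 1)
    (fun m => Eventually.of_forall fun ω => norm_expNeg_le_one hθ.le _)
    (ae_restrict_of_ae (ae_tendsto_expNeg_grid hp hQ hZ hF hθ k t))
  have hn' : (P.real (Z t ⁻¹' {n}) : ℂ) ≠ 0 := by
    rw [Complex.ofReal_ne_zero]
    exact fun h => hn ((measureReal_eq_zero_iff).1 h)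
  rw [condLST_eq]
  refine (h1.const_mul _).congr fun m => ?_
  rw [setIntegral_expNeg_grid hp hZ F hθ (mesh_pos m), inv_mul_cancel_left₀ hn']

theorem tendsto_condLST_add_mesh [IsProbabilityMeasure P] (hp : IsTransitionFunction p)
    (hQ : HasTransitionRates p Q) (hZ : IsMarkovChain P Z p) {F : Set (E × E)}
    (hF : ∀ n, (n, n) ∉ F) {θ : ℂ} (hθ : 0 ≤ θ.re) (k : ℕ) (t : ℝ≥0) (n : E) :
    Tendsto (fun m => condLST P Z F t k (θ + (mesh m : ℝ)) n) atTop
      (𝓝 (condLST P Z F t k θ n)) := by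
  have hθm : ∀ m, 0 ≤ (θ + (mesh m : ℝ)).re := fun m => by
    simpa using add_nonneg hθ (mesh m).2
  exact tendsto_integral_of_dominated_convergence (fun _ => (1 : ℝ))
    (fun m => (integrable_expNeg hp hQ hZ hF (hθm m) k t n).aestronglyMeasurable)
    (integrable_const 1)
    (fun m => Eventually.of_forall fun ω => norm_expNeg_le_one (hθm m) _)
    (Eventually.of_forall fun _ => tendsto_expNeg_add_mesh θ _)

theorem condLST_eq_condLST [IsProbabilityMeasure P] (hp : IsTransitionFunction p)
    (hQ : HasTransitionRates p Q) (hZ : IsMarkovChain P Z p) {F : Set (E × E)}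
    (hF : ∀ n, (n, n) ∉ F) {θ : ℂ} (hθ : 0 ≤ θ.re) (k : ℕ) {s t : ℝ≥0} {n : E}
    (hs : P (Z s ⁻¹' {n}) ≠ 0) (ht : P (Z t ⁻¹' {n}) ≠ 0) :
    condLST P Z F s k θ n = condLST P Z F t k θ n := by
  refine tendsto_nhds_unique (tendsto_condLST_add_mesh hp hQ hZ hF hθ k s n)
    ((tendsto_condLST_add_mesh hp hQ hZ hF hθ k t n).congr fun m => ?_)
  have hθm : 0 < (θ + (mesh m : ℝ)).re := by
    simpa using add_pos_of_nonneg_of_pos hθ (NNReal.coe_pos.2 (mesh_pos m))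
  exact tendsto_nhds_unique (tendsto_gridMean_condLST hp hQ hZ hF hθm k t n ht)
    (tendsto_gridMean_condLST hp hQ hZ hF hθm k s n hs)

end MarkovChain

/-! ### Scheffé's lemma for series. -/

/-- Write `|a - q| = (a - q) + 2 (q - a)⁺`: the first part sums to a null sequence by `hsum`, the
second is dominated by `q`. -/
theorem tendsto_tsum_abs_sub {S ι : Type*} {l : Filter ι} {a : ι → S → ℝ} {q : S → ℝ}
    (ha : ∀ m i, 0 ≤ a m i) (hq : ∀ i, 0 ≤ q i)
    (has : ∀ m, Summable (a m)) (hqs : Summable q) (hlim : ∀ i, Tendsto (a · i) l (𝓝 (q i)))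
    (hsum : Tendsto (fun m => ∑' i, a m i) l (𝓝 (∑' i, q i))) :
    Tendsto (fun m => ∑' i, |a m i - q i|) l (𝓝 0) := by
  have hpos : Tendsto (fun m => ∑' i, max (q i - a m i) 0) l (𝓝 (∑' _ : S, (0 : ℝ))) := by
    refine tendsto_tsum_of_dominated_convergence hqs (fun i => ?_)
      (Eventually.of_forall fun m i => ?_)
    · simpa using ((hlim i).const_sub (q i)).max (tendsto_const_nhds (x := (0 : ℝ)))
    · rw [Real.norm_of_nonneg (le_max_right _ _)]
      exact max_le (by linarith [ha m i]) (hq i)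
  have hps : ∀ m, Summable fun i => max (q i - a m i) 0 := fun m =>
    Summable.of_nonneg_of_le (fun i => le_max_right _ _)
      (fun i => max_le (by linarith [ha m i]) (hq i)) hqs
  have h := (hsum.sub_const (∑' i, q i)).add (hpos.const_mul 2)
  simp only [sub_self, tsum_zero, mul_zero, add_zero] at h
  refine h.congr fun m => ?_
  rw [← (has m).tsum_sub hqs, ← tsum_mul_left,
    ← ((has m).sub hqs).tsum_add ((hps m).mul_left 2)]
  refine tsum_congr fun i => ?_
  rcases le_total (a m i) (q i) with h | h
  · rw [abs_of_nonpos (by linarith), max_eq_left (by linarith)]; ring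
  · rw [abs_of_nonneg (by linarith), max_eq_right (by linarith)]; ring

/-- Convergence of `b` is asked only where `q i ≠ 0`, since transforms at states never visited carry
no information. -/
theorem tendsto_tsum_mul_of_tendsto_tsum {S ι : Type*} {l : Filter ι} {a : ι → S → ℝ} {q : S → ℝ}
    (ha : ∀ m i, 0 ≤ a m i) (hq : ∀ i, 0 ≤ q i)
    (has : ∀ m, Summable (a m)) (hqs : Summable q) (hlim : ∀ i, Tendsto (a · i) l (𝓝 (q i)))
    (hsum : Tendsto (fun m => ∑' i, a m i) l (𝓝 (∑' i, q i)))
    {b : ι → S → ℂ} {c : S → ℂ} (hb : ∀ m i, ‖b m i‖ ≤ 1)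
    (hbc : ∀ i, q i ≠ 0 → Tendsto (b · i) l (𝓝 (c i))) :
    Tendsto (fun m => ∑' i, (a m i : ℂ) * b m i) l (𝓝 (∑' i, (q i : ℂ) * c i)) := by
  have h1 : Tendsto (fun m => ∑' i, (q i : ℂ) * b m i) l (𝓝 (∑' i, (q i : ℂ) * c i)) := by
    refine tendsto_tsum_of_dominated_convergence hqs (fun i => ?_)
      (Eventually.of_forall fun m i => ?_)
    · by_cases hi : q i = 0
      · simp only [hi, Complex.ofReal_zero, zero_mul]
        exact tendsto_const_nhds
      · exact (hbc i hi).const_mul _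
    · rw [norm_mul, Complex.norm_of_nonneg (hq i)]
      exact mul_le_of_le_one_right (hq i) (hb m i)
  have h2 : Tendsto (fun m => ∑' i, ((a m i : ℂ) * b m i - (q i : ℂ) * b m i)) l (𝓝 0) := by
    refine squeeze_zero_norm (fun m => ?_) (tendsto_tsum_abs_sub ha hq has hqs hlim hsum)
    refine tsum_of_norm_bounded ((has m).sub hqs).abs.hasSum fun i => ?_
    rw [← sub_mul, norm_mul, ← Complex.ofReal_sub, Complex.norm_real, Real.norm_eq_abs]
    exact mul_le_of_le_one_right (abs_nonneg _) (hb m i)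
  have h3 := h2.add h1
  rw [zero_add] at h3
  refine h3.congr fun m => ?_
  rw [(summable_mul_of_norm_le_one (ha m) (has m) (hb m)).tsum_sub
    (summable_mul_of_norm_le_one hq hqs (hb m)), sub_add_cancel]

theorem tendsto_one_sub_exp_div (θ : ℂ) :
    Tendsto (fun m => (1 - Complex.exp (-θ * (mesh m : ℝ))) / (mesh m : ℝ)) atTop (𝓝 θ) := by
  have hd : HasDerivAt (fun x : ℂ => Complex.exp (-θ * x)) (-θ) 0 := by
    have := ((hasDerivAt_id (0 : ℂ)).const_mul (-θ)).cexp
    simpa using this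
  have hm : Tendsto (fun m => ((mesh m : ℝ) : ℂ)) atTop (𝓝[≠] 0) := by
    refine tendsto_nhdsWithin_iff.2 ⟨tendsto_ofReal_mesh, Eventually.of_forall fun m => ?_⟩
    simpa using (mesh_pos m).ne'
  have := ((hasDerivAt_iff_tendsto_slope_zero.1 hd).comp hm).neg
  rw [neg_neg] at this
  refine this.congr fun m => ?_
  simp only [Function.comp_apply, zero_add, mul_zero, Complex.exp_zero, smul_eq_mul]
  ring

/-! ### The recurrence in the limit. -/

section Recurrence

variable {Ω : Type*} [MeasurableSpace Ω] {P : Measure Ω} [IsProbabilityMeasure P] {E : Set ℕ}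
  {Z : ℝ≥0 → Ω → E} {p : ℝ≥0 → E → E → ℝ} {Q : E → E → ℝ}

theorem HasTransitionRates.nonneg (hp : IsTransitionFunction p) (hQ : HasTransitionRates p Q)
    (i j : E) : 0 ≤ Q i j := by
  rcases eq_or_ne i j with rfl | hij
  · exact (hQ.rate_self i).ge
  · exact ge_of_tendsto (hQ.tendsto_rate i j hij)
      (Eventually.of_forall fun h => div_nonneg (hp.nonneg _ _ _) h.2)

/-- If `n'` is never charged, the Markov property gives `p h n n' = 0` for all `h`, hence a zero
rate. -/
theorem exists_visit_of_rate_ne_zero (hQ : HasTransitionRates p Q)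
    (hZ : IsMarkovChain P Z p) {t : ℝ≥0} {n n' : E} (hn : P (Z t ⁻¹' {n}) ≠ 0)
    (hnn' : Q n n' ≠ 0) : ∃ s, P (Z s ⁻¹' {n'}) ≠ 0 := by
  by_contra! hcon
  have hne : n ≠ n' := fun h => hnn' (h ▸ hQ.rate_self n)
  refine hnn' (tendsto_nhds_unique (hQ.tendsto_rate n n' hne) (tendsto_const_nhds.congr fun h => ?_))
  have h1 := hZ.markov t h n n' Set.univ MeasurableSet.univ
  rw [Set.univ_inter, (measureReal_eq_zero_iff).2 (measure_mono_null Set.inter_subset_right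
    (hcon (t + h)))] at h1
  have h2 : P.real (Z t ⁻¹' {n}) ≠ 0 := fun h => hn ((measureReal_eq_zero_iff).1 h)
  rw [(mul_eq_zero.1 h1.symm).resolve_left h2, zero_div]

open Classical in
/-- The transform of the time until the `k`-th jump in `F` from the state `n`, taken at some time at
which `n` has positive probability. -/
noncomputable def stateLST (P : Measure Ω) (Z : ℝ≥0 → Ω → E) (F : Set (E × E)) (n : E) (k : ℕ)
    (θ : ℂ) : ℂ :=
  if k = 0 then 1 else if h : ∃ t, P (Z t ⁻¹' {n}) ≠ 0 then condLST P Z F h.choose k θ n else 0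

theorem stateLST_eq_condLST (hp : IsTransitionFunction p)
    (hQ : HasTransitionRates p Q) (hZ : IsMarkovChain P Z p) {F : Set (E × E)}
    (hF : ∀ n, (n, n) ∉ F) {θ : ℂ} (hθ : 0 ≤ θ.re) (k : ℕ) {t : ℝ≥0} {n : E}
    (hn : P (Z t ⁻¹' {n}) ≠ 0) : stateLST P Z F n k θ = condLST P Z F t k θ n := by
  have h : ∃ t, P (Z t ⁻¹' {n}) ≠ 0 := ⟨t, hn⟩
  rw [stateLST]
  split_ifs with hk
  · rw [hk, condLST_zero F t θ n hn]
  · exact condLST_eq_condLST hp hQ hZ hF hθ k h.choose_spec hn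

theorem norm_stateLST_le_one (F : Set (E × E)) {θ : ℂ} (hθ : 0 ≤ θ.re) (n : E) (k : ℕ) :
    ‖stateLST P Z F n k θ‖ ≤ 1 := by
  rw [stateLST]
  split_ifs with hk h
  · simp
  · exact norm_condLST_le_one F _ k hθ n h.choose_spec
  · simp

open Classical in
theorem stateLST_recurrence_of_pos (hp : IsTransitionFunction p)
    (hQ : HasTransitionRates p Q) (hZ : IsMarkovChain P Z p) {F : Set (E × E)}
    (hF : ∀ n, (n, n) ∉ F) {θ : ℂ} (hθ : 0 < θ.re) (k : ℕ) {t : ℝ≥0} {n : E}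
    (hn : P (Z t ⁻¹' {n}) ≠ 0) :
    ((∑' n', Q n n' : ℝ) + θ) * stateLST P Z F n (k + 1) θ =
      ∑' n', (Q n n' : ℂ) * stateLST P Z F n' (if (n, n') ∈ F then k else k + 1) θ := by
  have hlim : ∀ n' k, (∃ s, P (Z s ⁻¹' {n'}) ≠ 0) →
      Tendsto (fun m => gridMean F (Complex.exp (-θ * (mesh m : ℝ))) (p (mesh m)) k n') atTop
        (𝓝 (stateLST P Z F n' k θ)) := by
    rintro n' k ⟨s, hs⟩
    rw [stateLST_eq_condLST hp hQ hZ hF hθ.le k hs]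
    exact tendsto_gridMean_condLST hp hQ hZ hF hθ k s n' hs
  have hr := fun m => norm_exp_neg_mul_lt_one hθ (mesh_pos m)
  have hb := fun m => norm_gridMean_le_one F (hr m) (hp.nonneg (mesh m)) (hp.hasSum_one (mesh m))
  set r : ℕ → ℂ := fun m => Complex.exp (-θ * (mesh m : ℝ))
  set g : ℕ → ℕ → E → ℂ := fun m k n => gridMean F (r m) (p (mesh m)) k n
  have hm0 : ∀ m, (mesh m : ℝ) ≠ 0 := fun m => by exact_mod_cast (mesh_pos m).ne'
  have hm0' : ∀ m, ((mesh m : ℝ) : ℂ) ≠ 0 := fun m => Complex.ofReal_ne_zero.2 (hm0 m)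
  -- the rates of leaving `n` for the chain observed with step `mesh m`
  set a : ℕ → E → ℝ := fun m n' => if n' = n then 0 else p (mesh m) n n' / mesh m with ha
  have hasum : ∀ m, HasSum (a m) ((1 - p (mesh m) n n) / mesh m) := by
    intro m
    have h1 := ((hp.hasSum_one (mesh m) n).update n 0).div_const (mesh m : ℝ)
    rw [zero_sub, neg_add_eq_sub] at h1
    refine (congrArg (HasSum · _) (funext fun n' => ?_)).mp h1
    by_cases h : n' = n <;> simp [ha, h]
  have hanonneg : ∀ m n', 0 ≤ a m n' := by
    intro m n'
    simp only [ha]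
    split_ifs
    · exact le_rfl
    · exact div_nonneg (hp.nonneg _ _ _) (mesh m).2
  have hatot := (hQ.tendsto_total_rate n).comp tendsto_mesh
  have hrhs : Tendsto (fun m => ∑' n', (a m n' : ℂ) * g m (if (n, n') ∈ F then k else k + 1) n')
      atTop (𝓝 (∑' n', (Q n n' : ℂ) *
        stateLST P Z F n' (if (n, n') ∈ F then k else k + 1) θ)) := by
    refine tendsto_tsum_mul_of_tendsto_tsum hanonneg (hQ.nonneg hp n) (fun m => (hasum m).summable)
      (hQ.summable_rate n) (fun n' => ?_) ?_ (fun m n' => hb m _ _) (fun n' hn' => ?_)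
    · by_cases h : n' = n
      · simp [ha, h, hQ.rate_self]
      · simpa [ha, h, Function.comp_def] using (hQ.tendsto_rate n n' (Ne.symm h)).comp tendsto_mesh
    · exact hatot.congr fun m => (hasum m).tsum_eq.symm
    · exact hlim _ _ (exists_visit_of_rate_ne_zero hQ hZ hn hn')
  have hr1 : Tendsto r atTop (𝓝 1) := by
    have h3 := (Complex.continuous_exp.tendsto _).comp (tendsto_ofReal_mesh.const_mul (-θ))
    rwa [mul_zero, Complex.exp_zero] at h3
  have hd : Tendsto (fun m => (((1 - p (mesh m) n n) / mesh m : ℝ) : ℂ)) atTop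
      (𝓝 ((∑' n', Q n n' : ℝ) : ℂ)) :=
    (Complex.continuous_ofReal.tendsto _).comp hatot
  have hlhs := (((hr1.mul hd).add (tendsto_one_sub_exp_div θ))).mul (hlim n (k + 1) ⟨t, hn⟩)
  have hrhs' := hr1.mul hrhs
  rw [one_mul] at hlhs hrhs'
  -- What remains is the exact skeleton identity at fixed mesh, with the diagonal term moved to the
  -- left.
  refine tendsto_nhds_unique hlhs (hrhs'.congr fun m => ?_)
  have hstep := gridMean_succ F (hr m) (hp.nonneg (mesh m)) (hp.hasSum_one (mesh m)) k n
  have hsum : HasSum (fun n' => (p (mesh m) n n' : ℂ) * g m (if (n, n') ∈ F then k else k + 1) n')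
      (∑' n', (p (mesh m) n n' : ℂ) * g m (if (n, n') ∈ F then k else k + 1) n') :=
    (summable_mul_of_norm_le_one (hp.nonneg (mesh m) n) (hp.hasSum_one (mesh m) n).summable
      fun n' => hb m _ _).hasSum
  have hsplit := ((hsum.update n 0).div_const ((mesh m : ℝ) : ℂ)).tsum_eq
  have hcongr : ∑' n', (a m n' : ℂ) * g m (if (n, n') ∈ F then k else k + 1) n' =
      ∑' n', Function.update
        (fun n' => (p (mesh m) n n' : ℂ) * g m (if (n, n') ∈ F then k else k + 1) n') n 0 n' /
          ((mesh m : ℝ) : ℂ) := by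
    refine tsum_congr fun n' => ?_
    by_cases h : n' = n
    · simp [ha, h]
    · simp only [ha, h, if_false, Function.update_of_ne, ne_eq, not_false_eq_true]
      push_cast
      ring
  rw [hcongr, hsplit]
  -- As `(n, n) ∉ F`, the diagonal term carries index `k + 1`, the same unknown as the left side.
  simp only [hF n, if_false]
  change g m (k + 1) n = r m * ∑' n', (p (mesh m) n n' : ℂ) *
    g m (if (n, n') ∈ F then k else k + 1) n' at hstep
  change _ = (r m * _ + (1 - r m) / _) * g m (k + 1) n
  set T := ∑' n', (p (mesh m) n n' : ℂ) * g m (if (n, n') ∈ F then k else k + 1) n'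
  push_cast
  have hmm := hm0' m
  field_simp
  linear_combination -hstep

open Classical in
theorem stateLST_recurrence (hp : IsTransitionFunction p)
    (hQ : HasTransitionRates p Q) (hZ : IsMarkovChain P Z p) {F : Set (E × E)}
    (hF : ∀ n, (n, n) ∉ F) {θ : ℂ} (hθ : 0 ≤ θ.re) (k : ℕ) {t : ℝ≥0} {n : E}
    (hn : P (Z t ⁻¹' {n}) ≠ 0) :
    ((∑' n', Q n n' : ℝ) + θ) * stateLST P Z F n (k + 1) θ =
      ∑' n', (Q n n' : ℂ) * stateLST P Z F n' (if (n, n') ∈ F then k else k + 1) θ := by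
  have hθm : ∀ m, 0 < (θ + (mesh m : ℝ)).re := fun m => by
    simpa using add_pos_of_nonneg_of_pos hθ (NNReal.coe_pos.2 (mesh_pos m))
  have hlim : ∀ n' k, (∃ s, P (Z s ⁻¹' {n'}) ≠ 0) →
      Tendsto (fun m => stateLST P Z F n' k (θ + (mesh m : ℝ))) atTop
        (𝓝 (stateLST P Z F n' k θ)) := by
    rintro n' k ⟨s, hs⟩
    rw [stateLST_eq_condLST hp hQ hZ hF hθ k hs]
    exact (tendsto_condLST_add_mesh hp hQ hZ hF hθ k s n').congr fun m =>
      (stateLST_eq_condLST hp hQ hZ hF (hθm m).le k hs).symm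
  have h3 := (((tendsto_ofReal_mesh.const_add θ).const_add ((∑' n', Q n n' : ℝ) : ℂ))).mul (hlim n (k + 1) ⟨t, hn⟩)
  rw [add_zero] at h3
  refine tendsto_nhds_unique h3 ?_
  refine (tendsto_tsum_mul_of_tendsto_tsum (fun _ => hQ.nonneg hp n) (hQ.nonneg hp n)
    (fun _ => hQ.summable_rate n) (hQ.summable_rate n) (fun _ => tendsto_const_nhds)
    tendsto_const_nhds (fun m n' => norm_stateLST_le_one F (hθm m).le n' (if (n, n') ∈ F then k else k + 1)) fun n' hn' =>
      hlim n' _ (exists_visit_of_rate_ne_zero hQ hZ hn hn')).congr fun m => ?_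
  exact (stateLST_recurrence_of_pos hp hQ hZ hF (hθm m) k hn).symm

end Recurrence

/-! ### Splitting the sum along `F`. -/

theorem mainTheorem4 {Ω : Type*} [MeasurableSpace Ω] (P : Measure Ω) [IsProbabilityMeasure P]
    (E : Set ℕ) (Z : ℝ≥0 → Ω → E) (p : ℝ≥0 → E → E → ℝ) (Q : E → E → ℝ)
    (hp : IsTransitionFunction p) (hQ : HasTransitionRates p Q) (hZ : IsMarkovChain P Z p)
    (d : E → ℝ) (hd : ∀ n, d n = ∑' n', Q n n') (hd_pos : ∀ n, 0 < d n)
    (F : Set (E × E)) (hF : ∀ n n', (n, n') ∈ F → 0 < Q n n') :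
    ∃ f : E → ℕ → ℂ → ℂ,
      (∀ n θ, f n 0 θ = 1) ∧
      (∀ n k θ, 1 ≤ k → 0 ≤ θ.re → ∀ t, P (Z t ⁻¹' {n}) ≠ 0 →
        Integrable (fun ω => expNeg θ (jumpTime F (fun u => Z u ω) t k)) (P[|Z t ⁻¹' {n}]) ∧
        condLST P Z F t k θ n = f n k θ) ∧
      (∀ n k θ, 1 ≤ k → 0 ≤ θ.re → (∃ t, P (Z t ⁻¹' {n}) ≠ 0) →
        Summable (fun n' : {n' : E // (n, n') ∉ F} => f n' k θ * (Q n n' : ℂ)) ∧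
        Summable (fun n' : {n' : E // (n, n') ∈ F} => f n' (k - 1) θ * (Q n n' : ℂ)) ∧
        f n k θ = 1 / ((d n : ℂ) + θ) *
          (∑' n' : {n' : E // (n, n') ∉ F}, f n' k θ * (Q n n' : ℂ) +
            ∑' n' : {n' : E // (n, n') ∈ F}, f n' (k - 1) θ * (Q n n' : ℂ))) := by
  classical
  have hF' := hQ.diagonal_notMem hF
  refine ⟨stateLST P Z F, fun n θ => by simp [stateLST], fun n k θ _ hθ t ht =>
    ⟨integrable_expNeg hp hQ hZ hF' hθ k t n, (stateLST_eq_condLST hp hQ hZ hF' hθ k ht).symm⟩, ?_⟩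
  rintro n k θ hk hθ ⟨t, ht⟩
  obtain ⟨k, rfl⟩ := Nat.exists_eq_add_of_le' hk
  rw [Nat.add_sub_cancel]
  have hsummable : ∀ κ : E → ℕ, Summable fun n' => stateLST P Z F n' (κ n') θ * (Q n n' : ℂ) :=
    fun κ => by
      simpa only [mul_comm] using summable_mul_of_norm_le_one (hQ.nonneg hp n) (hQ.summable_rate n)
        fun n' => norm_stateLST_le_one (P := P) (Z := Z) F hθ n' (κ n')
  refine ⟨(hsummable fun _ => k + 1).subtype {n' | (n, n') ∉ F},
    (hsummable fun _ => k).subtype {n' | (n, n') ∈ F}, ?_⟩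
  -- Its real part is at least `d n > 0`, also when `Re θ = 0`.
  have hne : (d n : ℂ) + θ ≠ 0 := by
    intro h
    have := congrArg Complex.re h
    simp only [Complex.add_re, Complex.ofReal_re, Complex.zero_re] at this
    linarith [hd_pos n]
  have hrec := stateLST_recurrence hp hQ hZ hF' hθ k ht
  rw [← hd n] at hrec
  rw [one_div, eq_inv_mul_iff_mul_eq₀ hne, hrec]
  have hs := hsummable fun n' => if (n, n') ∈ F then k else k + 1
  have hsplit := Summable.tsum_add_tsum_compl (s := {n' | (n, n') ∈ F}) (hs.subtype _)
    (hs.subtype _)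
  simp_rw [mul_comm (Q n _ : ℂ)]
  rw [← hsplit, add_comm]
  congr 1
  · exact tsum_congr fun n' : {n' : E // (n, n') ∉ F} => by
      rw [if_neg (show (n, (n' : E)) ∉ F from n'.2)]
  · exact tsum_congr fun n' : {n' : E // (n, n') ∈ F} => by
      rw [if_pos (show (n, (n' : E)) ∈ F from n'.2)]
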